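/- Let $\mathrm{Homeo}^+(\mathbb R)$ be the group of orientation preserving homeomorphisms of $\mathbb R$, and for $f\in\mathrm{Homeo}^+(\mathbb R)$ let $\operatorname{supp} f=\{x\in\mathbb R: f(x)\neq x\}$. Let $F=\langle a,b\rangle\le\mathrm{Homeo}^+(\mathbb R)$ be the standard copy of Thompson's group $F$, where $a(x)=x+1$ for all $x$, and $b(x)=x$ for $x\le 0$, $b(x)=2x$ for $0<x<1$, $b(x)=x+1$ for $x\ge 1$. For an integer $n\ge 2$, an $n$-chain group is a subgroup of $\mathrm{Homeo}^+(\mathbb R)$ of the form $\langle f_1,\dots,f_n\rangle$, where $f_1,\dots,f_n\in\mathrm{Homeo}^+(\mathbb R)$ satisfy the following conditions: 1. each $J_i=\operatorname{supp} f_i$ is a nonempty open (possibly unbounded) interval, $J_i\cap J_k=\varnothing$ whenever $|i-k|>1$, and, for $1\le i\le n-1$, $J_i\cap J_{i+1}$ is a nonempty interval which is properly contained in $J_i$ and in $J_{i+1}$; 2. $\inf J_i<\inf J_{i+1}$ in $[-\infty,\infty]$ for $1\le i\le n-1$; 3. $f_i(t)\ge t$ for all $t\in\mathbb R$ and $1\le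 i\le n$; 4. the group $\langle f_i,f_{i+1}\rangle$ is isomorphic to $F$ for $1\le i\le n-1$. **Proposition.** Let $m\ge n\ge 2$ be integers. Every $n$-chain group is isomorphic, as an abstract group, to some $m$-chain group. -/

import Mathlib

noncomputable section

namespace ChainGroup

/-- The group of orientation preserving homeomorphisms of the real line. -/
def HomeoPlus : Subgroup (ℝ ≃ₜ ℝ) where
  carrier := {f | StrictMono f}
  one_mem' := fun _ _ h => h
  mul_mem' := fun {f g} hf hg x y h => by
    show f (g x) < f (g y)
    exact hf (hg h)
  inv_mem' := fun {f} hf x y h => by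
    show f.symm x < f.symm y
    apply (StrictMono.lt_iff_lt hf).1
    simpa using h

/-- The support of a homeomorphism of the line: the set of points which it moves
(no closure is taken). -/
def supp (f : HomeoPlus) : Set ℝ := {x | (f : ℝ ≃ₜ ℝ) x ≠ x}

/-- The left endpoint of an interval, an extended real number. -/
def leftEnd (J : Set ℝ) : EReal := sInf ((fun x : ℝ => (x : EReal)) '' J)

/-- The map `b`: the identity on `(-∞, 0]`, `x ↦ 2 x` on `(0, 1)`, `x ↦ x + 1` on `[1, ∞)`. -/
def bFun (x : ℝ) : ℝ := if x ≤ 0 then x else if x < 1 then 2 * x else x + 1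

/-- The inverse of `b`. -/
def bInv (y : ℝ) : ℝ := if y ≤ 0 then y else if y < 2 then y / 2 else y - 1

theorem bFun_eq (x : ℝ) : bFun x = max x (min (2 * x) (x + 1)) := by
  unfold bFun
  split_ifs <;> rcases max_cases x (min (2 * x) (x + 1)) with h | h <;>
    rcases min_cases (2 * x) (x + 1) with h' | h' <;> linarith

theorem bInv_eq (y : ℝ) : bInv y = min y (max (y / 2) (y - 1)) := by
  unfold bInv
  split_ifs <;> rcases min_cases y (max (y / 2) (y - 1)) with h | h <;>
    rcases max_cases (y / 2) (y - 1) with h' | h' <;> linarith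

theorem bInv_bFun (x : ℝ) : bInv (bFun x) = x := by
  unfold bFun bInv
  split_ifs <;> linarith

theorem bFun_bInv (y : ℝ) : bFun (bInv y) = y := by
  unfold bFun bInv
  split_ifs <;> linarith

theorem bFun_strictMono : StrictMono bFun := by
  intro x y h
  unfold bFun
  split_ifs <;> linarith

theorem continuous_bFun : Continuous bFun := by
  have h : bFun = fun x => max x (min (2 * x) (x + 1)) := funext bFun_eq
  rw [h]
  fun_prop

theorem continuous_bInv : Continuous bInv := by
  have h : bInv = fun y => min y (max (y / 2) (y - 1)) := funext bInv_eq
  rw [h]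
  fun_prop

/-- The translation `a x = x + 1`, as an element of `Homeo⁺(ℝ)`. -/
def a : HomeoPlus :=
  ⟨Homeomorph.addRight (1 : ℝ), fun x y h => by
    show x + 1 < y + 1
    linarith⟩

/-- The map `b` as an element of `Homeo⁺(ℝ)`. -/
def b : HomeoPlus :=
  ⟨{ toFun := bFun
     invFun := bInv
     left_inv := bInv_bFun
     right_inv := bFun_bInv
     continuous_toFun := continuous_bFun
     continuous_invFun := continuous_bInv }, bFun_strictMono⟩

/-- The standard copy `⟨a, b⟩` of Thompson's group `F` in `Homeo⁺(ℝ)`. -/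
def thompsonF : Subgroup HomeoPlus := Subgroup.closure {a, b}

/-- `J 0, …, J (n - 1)` is an `n`-chain of intervals: nonempty open intervals of the line,
disjoint for indices at distance more than one, and such that consecutive ones meet in a
nonempty interval properly contained in both.  (The intersection is automatically an
interval.) -/
structure IsChainOfIntervals {n : ℕ} (J : Fin n → Set ℝ) : Prop where
  isOpen : ∀ i, IsOpen (J i)
  nonempty : ∀ i, (J i).Nonempty
  ordConnected : ∀ i, (J i).OrdConnected
  disjoint : ∀ i k : Fin n, (i : ℕ) + 1 < k → J i ∩ J k = ∅
  inter_nonempty : ∀ i k : Fin n, (i : ℕ) + 1 = k → (J i ∩ J k).Nonempty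
  inter_ssubset_left : ∀ i k : Fin n, (i : ℕ) + 1 = k → J i ∩ J k ⊂ J i
  inter_ssubset_right : ∀ i k : Fin n, (i : ℕ) + 1 = k → J i ∩ J k ⊂ J k

/-- `f 0, …, f (n - 1)` are the distinguished generators of an `n`-prechain group: their
supports form a chain of intervals listed from left to right, and no `f i` moves a point
to the left. -/
structure IsPrechain {n : ℕ} (f : Fin n → HomeoPlus) : Prop where
  two_le : 2 ≤ n
  chain : IsChainOfIntervals (fun i => supp (f i))
  leftEnd_lt : ∀ i k : Fin n, (i : ℕ) + 1 = k → leftEnd (supp (f i)) < leftEnd (supp (f k))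
  le_apply : ∀ (i : Fin n) (t : ℝ), t ≤ (f i : ℝ ≃ₜ ℝ) t

/-- `G` is an `n`-chain group: it is generated by the distinguished generators of an
`n`-prechain group, any two consecutive ones of which generate a group isomorphic to
Thompson's group `F`. -/
def IsChainGroup (n : ℕ) (G : Subgroup HomeoPlus) : Prop :=
  ∃ f : Fin n → HomeoPlus, IsPrechain f ∧ G = Subgroup.closure (Set.range f) ∧
    ∀ i k : Fin n, (i : ℕ) + 1 = k →
      Nonempty (Subgroup.closure {f i, f k} ≃* thompsonF)

end ChainGroup

end

namespace ChainGroup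

/-! ### The action on the line -/

/-! The group itself is an m-chain group: from n generators one obtains n + 1 generators of the same
subgroup by splitting the first one. Let f, g be the first two generators, let supp f end at s and
supp g begin at t, and let k be a power of g with k f t ≥ s. Put f' = k⁻¹ f k and c = f'⁻¹ f, so
that f = f' c. Replace f, g by f', c, f g f⁻¹ and keep the rest. Here supp c = (f⁻¹ t, s), supp f'
ends at k⁻¹ s ≤ f t, and supp (f g f⁻¹) begins at f t, so the supports again form a chain.

It remains to recognise F in consecutive pairs. For (f', c), a dynamical criterion applies: two
right-moving maps with suitably overlapping supports yield a sequence satisfying the relations of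
the infinite presentation of F. Every word then equals q⁻¹ p with p, q sorted positive words, and
the action separates sorted positive words; hence exactly the same words are trivial as for the
standard generators. For (c, f g f⁻¹), c agrees with f on [f t, ∞), where f g f⁻¹ acts, and the two
pairs satisfy the same relations. The third pair is conjugate by f to an old pair, since f commutes
with the third old generator. -/

instance : MulAction HomeoPlus ℝ where
  smul f x := (f : ℝ ≃ₜ ℝ) x
  one_smul _ := rfl
  mul_smul _ _ _ := rfl

theorem mem_supp {f : HomeoPlus} {x : ℝ} : x ∈ supp f ↔ f • x ≠ x := Iff.rfl

theorem smul_strictMono (f : HomeoPlus) : StrictMono fun x : ℝ => f • x := f.2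

theorem smul_lt {f : HomeoPlus} {x y : ℝ} : f • x < f • y ↔ x < y :=
  (smul_strictMono f).lt_iff_lt

theorem smul_le {f : HomeoPlus} {x y : ℝ} : f • x ≤ f • y ↔ x ≤ y :=
  (smul_strictMono f).le_iff_le

theorem continuous_smul_const (f : HomeoPlus) : Continuous fun x : ℝ => f • x :=
  (f : ℝ ≃ₜ ℝ).continuous

theorem HomeoPlus.ext_smul {f g : HomeoPlus} (h : ∀ x : ℝ, f • x = g • x) : f = g :=
  Subtype.ext (Homeomorph.ext h)

theorem inv_smul_le_of_le {f : HomeoPlus} {x y : ℝ} (h : x ≤ f • y) : f⁻¹ • x ≤ y := by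
  rw [← smul_le (f := f), smul_inv_smul]; exact h

theorem inv_smul_eq_self {f : HomeoPlus} {x : ℝ} : f⁻¹ • x = x ↔ f • x = x := by
  rw [inv_smul_eq_iff, eq_comm]

theorem le_pow_smul {f : HomeoPlus} (hf : ∀ x : ℝ, x ≤ f • x) (n : ℕ) (x : ℝ) :
    x ≤ f ^ n • x := by
  induction n with
  | zero => simp
  | succ n ih => rw [pow_succ', mul_smul]; exact ih.trans (hf _)

theorem pow_smul_eq_self {f : HomeoPlus} {x : ℝ} (h : f • x = x) (n : ℕ) : f ^ n • x = x := by
  induction n with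
  | zero => simp
  | succ n ih => rw [pow_succ, mul_smul, h, ih]

theorem le_conj_smul {f g : HomeoPlus} (hf : ∀ x : ℝ, x ≤ f • x) (x : ℝ) :
    x ≤ (g * f * g⁻¹) • x := by
  rw [mul_smul, mul_smul]
  calc x = g • g⁻¹ • x := (smul_inv_smul _ _).symm
    _ ≤ _ := smul_le.2 (hf _)

theorem supp_conj (f g : HomeoPlus) : supp (g * f * g⁻¹) = (fun x : ℝ => g⁻¹ • x) ⁻¹' supp f := by
  ext x
  rw [Set.mem_preimage, mem_supp, mem_supp, mul_smul, mul_smul, ne_eq, ne_eq, eq_inv_smul_iff]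

/-- Iterating a homeomorphism without fixed points in `[y, p]` takes `y` past `p`. -/
theorem exists_le_pow_smul {f : HomeoPlus} (hf : ∀ x : ℝ, x ≤ f • x) {y p : ℝ}
    (h : ∀ x, y ≤ x → x ≤ p → f • x ≠ x) : ∃ n : ℕ, p ≤ f ^ n • y := by
  -- Otherwise the orbit of `y` is monotone and bounded by `p`, and its limit is a fixed point in
  -- `[y, p]`.
  by_contra! hlt
  have hmono : Monotone fun n : ℕ => f ^ n • y :=
    monotone_nat_of_le_succ fun n => by rw [pow_succ', mul_smul]; exact hf _
  have hbdd : BddAbove (Set.range fun n : ℕ => f ^ n • y) :=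
    ⟨p, by rintro _ ⟨n, rfl⟩; exact (hlt n).le⟩
  have hlim := tendsto_atTop_ciSup hmono hbdd
  set L := ⨆ n : ℕ, f ^ n • y with hL
  have h1 : Filter.Tendsto (fun n : ℕ => f • (f ^ n • y)) Filter.atTop (nhds (f • L)) :=
    ((continuous_smul_const f).tendsto L).comp hlim
  have h2 : Filter.Tendsto (fun n : ℕ => f • (f ^ n • y)) Filter.atTop (nhds L) := by
    have := hlim.comp (Filter.tendsto_add_atTop_nat 1)
    refine this.congr fun n => ?_
    simp only [Function.comp_apply]
    rw [pow_succ', mul_smul]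
  refine h L ?_ (ciSup_le fun n => (hlt n).le) (tendsto_nhds_unique h1 h2)
  simpa using le_ciSup hbdd 0

/-! ### Isomorphisms from equality of relations -/

/-- Two groups generated by families satisfying the same relations are isomorphic. -/
theorem nonempty_closure_mulEquiv {ι G : Type*} [Group G] (x y : ι → G)
    (h : ∀ w, FreeGroup.lift x w = 1 ↔ FreeGroup.lift y w = 1) :
    Nonempty (Subgroup.closure (Set.range x) ≃* Subgroup.closure (Set.range y)) := by
  have hker : (FreeGroup.lift x).ker = (FreeGroup.lift y).ker := by
    ext w
    exact h w
  rw [← FreeGroup.range_lift_eq_closure, ← FreeGroup.range_lift_eq_closure]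
  exact ⟨(QuotientGroup.quotientKerEquivRange _).symm.trans
    ((QuotientGroup.quotientMulEquivOfEq hker).trans (QuotientGroup.quotientKerEquivRange _))⟩

theorem range_bool {G : Type*} (u v : G) : Set.range (fun i : Bool => cond i u v) = {u, v} := by
  ext z
  simp [eq_comm, or_comm]

theorem nonempty_closure_pair_mulEquiv {G : Type*} [Group G] (u v u' v' : G)
    (h : ∀ w : FreeGroup Bool, FreeGroup.lift (fun i => cond i u v) w = 1 ↔
      FreeGroup.lift (fun i => cond i u' v') w = 1) :
    Nonempty (Subgroup.closure {u, v} ≃* Subgroup.closure {u', v'}) := by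
  have := nonempty_closure_mulEquiv _ _ h
  rwa [range_bool, range_bool] at this

theorem nonempty_closure_pair_conj {G : Type*} [Group G] (g u v : G) :
    Nonempty (Subgroup.closure {g * u * g⁻¹, g * v * g⁻¹} ≃* Subgroup.closure {u, v}) := by
  refine nonempty_closure_pair_mulEquiv _ _ _ _ fun w => ?_
  have : FreeGroup.lift (fun i => cond i (g * u * g⁻¹) (g * v * g⁻¹)) =
      (MulAut.conj g).toMonoidHom.comp (FreeGroup.lift fun i => cond i u v) := by
    ext i
    cases i <;> simp
  rw [this]
  simp

/-! ### Normal forms in Thompson's group -/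

/-- The relations of the infinite presentation of Thompson's group. -/
def ThompsonRelations {G : Type*} [Group G] (x : ℕ → G) : Prop :=
  ∀ k n, k < n → x k * x n = x (n + 1) * x k

/-- Insertion of a letter on the left of a positive word with nonincreasing indices. -/
def insertLetter (k : ℕ) : List ℕ → List ℕ
  | [] => [k]
  | n :: l => if k < n then (n + 1) :: insertLetter k l else k :: n :: l

theorem le_of_mem_insertLetter {k B : ℕ} (hk : k ≤ B + 1) {l : List ℕ} (hl : ∀ i ∈ l, i ≤ B) :
    ∀ i ∈ insertLetter k l, i ≤ B + 1 := by
  induction l with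
  | nil => simpa [insertLetter] using hk
  | cons n l ih =>
    rw [List.forall_mem_cons] at hl
    unfold insertLetter
    split_ifs
    · rw [List.forall_mem_cons]
      exact ⟨by omega, ih hl.2⟩
    · intro i hi
      rcases List.mem_cons.1 hi with rfl | hi
      · exact hk
      · rcases List.mem_cons.1 hi with rfl | hi
        · omega
        · have := hl.2 i hi
          omega

theorem pairwise_insertLetter (k : ℕ) {l : List ℕ} (hl : l.Pairwise (· ≥ ·)) :
    (insertLetter k l).Pairwise (· ≥ ·) := by
  induction l with
  | nil => simp [insertLetter]
  | cons n l ih =>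
    have hl' := List.pairwise_cons.1 hl
    unfold insertLetter
    split_ifs with h
    · exact List.pairwise_cons.2
        ⟨le_of_mem_insertLetter (by omega) hl'.1, ih hl'.2⟩
    · refine List.pairwise_cons.2 ⟨fun i hi => ?_, hl⟩
      rcases List.mem_cons.1 hi with rfl | hi
      · omega
      · have := hl'.1 i hi
        omega

theorem prod_insertLetter {G : Type*} [Group G] {x : ℕ → G} (hx : ThompsonRelations x) (k : ℕ)
    (l : List ℕ) : ((insertLetter k l).map x).prod = x k * (l.map x).prod := by
  induction l with
  | nil => simp [insertLetter]
  | cons n l ih =>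
    unfold insertLetter
    split_ifs with h
    · rw [List.map_cons, List.prod_cons, ih, List.map_cons, List.prod_cons, ← mul_assoc,
        ← mul_assoc, hx k n h]
    · simp

/-- Positive words can be sorted. -/
theorem exists_pairwise_prod_eq (l : List ℕ) : ∃ p : List ℕ, p.Pairwise (· ≥ ·) ∧
    ∀ (G : Type) [Group G] (x : ℕ → G), ThompsonRelations x →
      (l.map x).prod = (p.map x).prod := by
  induction l with
  | nil => exact ⟨[], by simp⟩
  | cons k l ih =>
    obtain ⟨p, hp, h⟩ := ih
    refine ⟨insertLetter k p, pairwise_insertLetter k hp, fun G _ x hx => ?_⟩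
    rw [prod_insertLetter hx, List.map_cons, List.prod_cons, h G x hx]

/-- A positive word followed by an inverse letter is a word of inverse letters followed by a
positive word. -/
theorem exists_prod_mul_inv_eq (l : List ℕ) : ∀ i : ℕ, ∃ q p : List ℕ,
    ∀ (G : Type) [Group G] (x : ℕ → G), ThompsonRelations x →
      (l.map x).prod * (x i)⁻¹ = ((q.map x).prod)⁻¹ * (p.map x).prod := by
  induction l using List.reverseRecOn with
  | nil => exact fun i => ⟨[i], [], fun G _ x _ => by simp⟩
  | append_singleton l n ih =>
    intro i
    rcases lt_trichotomy n i with h | rfl | h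
    · obtain ⟨q, p, hqp⟩ := ih (i + 1)
      refine ⟨q, p ++ [n], fun G _ x hx => ?_⟩
      have h1 : x n * (x i)⁻¹ = (x (i + 1))⁻¹ * x n := by
        rw [mul_inv_eq_iff_eq_mul, mul_assoc, hx n i h, inv_mul_cancel_left]
      simp only [List.map_append, List.prod_append, List.map_cons, List.map_nil, List.prod_cons,
        List.prod_nil, mul_one]
      rw [mul_assoc, h1, ← mul_assoc, hqp G x hx, mul_assoc]
    · exact ⟨[], l, fun G _ x _ => by simp⟩
    · obtain ⟨q, p, hqp⟩ := ih i
      refine ⟨q, p ++ [n + 1], fun G _ x hx => ?_⟩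
      have h1 : x n * (x i)⁻¹ = (x i)⁻¹ * x (n + 1) := by
        rw [mul_inv_eq_iff_eq_mul, mul_assoc, ← hx i n h, inv_mul_cancel_left]
      simp only [List.map_append, List.prod_append, List.map_cons, List.map_nil, List.prod_cons,
        List.prod_nil, mul_one]
      rw [mul_assoc, h1, ← mul_assoc, hqp G x hx, mul_assoc]

/-- The words `q`, `p` are chosen before the group: the rewriting uses only the relations, so one
normal form serves two sequences at once. -/
theorem exists_lift_eq (w : FreeGroup ℕ) : ∃ q p : List ℕ,
    ∀ (G : Type) [Group G] (x : ℕ → G), ThompsonRelations x →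
      FreeGroup.lift x w = ((q.map x).prod)⁻¹ * (p.map x).prod := by
  suffices H : ∀ L : List (ℕ × Bool), ∃ q p : List ℕ,
      ∀ (G : Type) [Group G] (x : ℕ → G), ThompsonRelations x →
        FreeGroup.lift x (FreeGroup.mk L) = ((q.map x).prod)⁻¹ * (p.map x).prod by
    rw [← FreeGroup.mk_toWord (x := w)]
    exact H w.toWord
  intro L
  induction L using List.reverseRecOn with
  | nil => exact ⟨[], [], fun G _ x _ => by simp⟩
  | append_singleton L z ih =>
    obtain ⟨q, p, h⟩ := ih
    obtain ⟨i, ε⟩ := z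
    cases ε
    · obtain ⟨q', p', h'⟩ := exists_prod_mul_inv_eq p i
      refine ⟨q' ++ q, p', fun G _ x hx => ?_⟩
      have h2 : FreeGroup.lift x (FreeGroup.mk [(i, false)]) = (x i)⁻¹ := by simp
      rw [← FreeGroup.mul_mk, _root_.map_mul, h G x hx, h2, mul_assoc, h' G x hx,
        List.map_append, List.prod_append, mul_inv_rev, mul_assoc]
    · refine ⟨q, p ++ [i], fun G _ x hx => ?_⟩
      have h2 : FreeGroup.lift x (FreeGroup.mk [(i, true)]) = x i := by simp
      rw [← FreeGroup.mul_mk, _root_.map_mul, h G x hx, h2, List.map_append, List.prod_append,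
        mul_assoc]
      simp

/-- A sequence satisfying the relations of Thompson's group and acting on the line as the standard
generators do: every term moves to the right a point fixed by all later ones. -/
structure IsThompsonSequence (x : ℕ → HomeoPlus) : Prop where
  rel : ThompsonRelations x
  le_smul : ∀ n (t : ℝ), t ≤ x n • t
  exists_lt : ∀ i, ∃ t : ℝ, t < x i • t ∧ ∀ k, i < k → x k • t = t

theorem le_prod_smul {x : ℕ → HomeoPlus} (hx : ∀ n (t : ℝ), t ≤ x n • t) (l : List ℕ) (t : ℝ) :
    t ≤ (l.map x).prod • t := by
  induction l with
  | nil => simp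
  | cons n l ih =>
    rw [List.map_cons, List.prod_cons, mul_smul]
    exact ih.trans (hx _ _)

theorem prod_smul_eq_self {x : ℕ → HomeoPlus} {l : List ℕ} {t : ℝ}
    (h : ∀ i ∈ l, x i • t = t) : (l.map x).prod • t = t := by
  induction l with
  | nil => simp
  | cons n l ih =>
    rw [List.forall_mem_cons] at h
    rw [List.map_cons, List.prod_cons, mul_smul, ih h.2, h.1]

/-- The letter `i` acts first and moves its witness `t` to the right; `p` cannot bring it back,
whereas every letter of `q` fixes `t`. -/
theorem IsThompsonSequence.prod_ne {x : ℕ → HomeoPlus} (hx : IsThompsonSequence x)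
    (p : List ℕ) {i : ℕ} {q : List ℕ} (h : ∀ j ∈ q, i < j) :
    ((p ++ [i]).map x).prod ≠ (q.map x).prod := by
  intro he
  obtain ⟨t, ht, hk⟩ := hx.exists_lt i
  have h1 := prod_smul_eq_self (x := x) (l := q) (t := t) fun j hj => hk j (h j hj)
  have h2 : x i • t ≤ ((p ++ [i]).map x).prod • t := by
    rw [List.map_append, List.prod_append, mul_smul]
    simpa using le_prod_smul hx.le_smul p (x i • t)
  rw [he, h1] at h2
  exact absurd ht (not_lt.2 h2)

/-- Sorted positive words are determined by the homeomorphisms they represent. -/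
theorem IsThompsonSequence.prod_inj {x : ℕ → HomeoPlus} (hx : IsThompsonSequence x)
    (p : List ℕ) : ∀ q : List ℕ, p.Pairwise (· ≥ ·) → q.Pairwise (· ≥ ·) →
      (p.map x).prod = (q.map x).prod → p = q := by
  induction p using List.reverseRecOn with
  | nil =>
    intro q _ _ h
    rcases List.eq_nil_or_concat' q with rfl | ⟨q, j, rfl⟩
    · rfl
    · exact absurd h.symm (hx.prod_ne q (by simp))
  | append_singleton p i ih =>
    intro q hp hq h
    rcases List.eq_nil_or_concat' q with rfl | ⟨q, j, rfl⟩
    · exact absurd h (hx.prod_ne p (by simp))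
    rw [List.pairwise_append] at hp hq
    -- A sorted word ends in its least letter. Different last letters contradict `prod_ne`; equal
    -- ones cancel.
    rcases lt_trichotomy i j with hij | rfl | hij
    · refine absurd h (hx.prod_ne p fun k hk => ?_)
      rcases List.mem_append.1 hk with hk | hk
      · exact hij.trans_le (hq.2.2 k hk j (by simp))
      · rwa [List.mem_singleton.1 hk]
    · rw [ih q hp.1 hq.1 (by simpa using h)]
    · refine absurd h.symm (hx.prod_ne q fun k hk => ?_)
      rcases List.mem_append.1 hk with hk | hk
      · exact hij.trans_le (hp.2.2 k hk i (by simp))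
      · rwa [List.mem_singleton.1 hk]

/-- In either group a word is trivial exactly when the two sorted words of its normal form coincide,
a condition independent of the sequence. -/
theorem IsThompsonSequence.nonempty_mulEquiv {x y : ℕ → HomeoPlus} (hx : IsThompsonSequence x)
    (hy : IsThompsonSequence y) :
    Nonempty (Subgroup.closure (Set.range x) ≃* Subgroup.closure (Set.range y)) := by
  refine nonempty_closure_mulEquiv _ _ fun w => ?_
  obtain ⟨q, p, h⟩ := exists_lift_eq w
  obtain ⟨q', hq', hq⟩ := exists_pairwise_prod_eq q
  obtain ⟨p', hp', hp⟩ := exists_pairwise_prod_eq p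
  have key : ∀ z : ℕ → HomeoPlus, IsThompsonSequence z →
      (FreeGroup.lift z w = 1 ↔ q' = p') := by
    intro z hz
    rw [h _ z hz.rel, hq _ z hz.rel, hp _ z hz.rel, inv_mul_eq_one]
    exact ⟨hz.prod_inj _ _ hq' hp', fun he => by rw [he]⟩
  rw [key x hx, key y hy]

/-! ### Pairs generating a copy of Thompson's group -/

/-- The standard infinite generating sequence attached to a pair of generators. -/
def thompsonSequence {G : Type*} [Group G] (X g : G) : ℕ → G
  | 0 => X
  | n + 1 => X ^ n * g * (X ^ n)⁻¹

theorem closure_range_thompsonSequence {G : Type*} [Group G] (f g : G) :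
    Subgroup.closure (Set.range (thompsonSequence (g * f) g)) = Subgroup.closure {f, g} := by
  apply le_antisymm
  · rw [Subgroup.closure_le]
    have hf : f ∈ Subgroup.closure {f, g} := Subgroup.subset_closure (by simp)
    have hg : g ∈ Subgroup.closure {f, g} := Subgroup.subset_closure (by simp)
    have hX := mul_mem hg hf
    rintro _ ⟨_ | n, rfl⟩
    · exact hX
    · exact mul_mem (mul_mem (pow_mem hX n) hg) (inv_mem (pow_mem hX n))
  · rw [Subgroup.closure_le]
    have h0 : g * f ∈ Subgroup.closure (Set.range (thompsonSequence (g * f) g)) :=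
      Subgroup.subset_closure ⟨0, rfl⟩
    have h1 : g ∈ Subgroup.closure (Set.range (thompsonSequence (g * f) g)) :=
      Subgroup.subset_closure ⟨1, by simp [thompsonSequence]⟩
    rintro z (rfl | rfl)
    · simpa using mul_mem (inv_mem h1) h0
    · exact h1

/-- The dynamical condition under which two homeomorphisms generate a copy of Thompson's group. -/
theorem isThompsonSequence_of_dynamics {f g : HomeoPlus} {t : ℝ} (hf : ∀ x : ℝ, x ≤ f • x)
    (hg : ∀ x : ℝ, x ≤ g • x) (hgt : ∀ x ≤ t, g • x = x)
    (hft : ∀ x : ℝ, g • f • t ≤ x → f • x = x) (hlt : t < g • f • t)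
    (hlt' : g • f • t < g • g • f • t) :
    IsThompsonSequence (thompsonSequence (g * f) g) := by
  have hX : ∀ x : ℝ, x ≤ (g * f) • x := fun x => by
    rw [mul_smul]; exact (hf x).trans (hg _)
  -- From index 2 on, the terms are the identity on `(-∞, g f t]`, while `f` is the identity on `[g
  -- f t, ∞)`.
  have hcomm0 : ∀ n, 1 ≤ n → f * thompsonSequence (g * f) g (n + 1) =
      thompsonSequence (g * f) g (n + 1) * f := by
    intro n hn
    have hx : ∀ x ≤ g • f • t, thompsonSequence (g * f) g (n + 1) • x = x := by
      intro x hx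
      obtain ⟨m, rfl⟩ := Nat.exists_eq_add_of_le' hn
      have : ((g * f) ^ (m + 1))⁻¹ • x ≤ t := by
        apply inv_smul_le_of_le
        rw [pow_succ, mul_smul, mul_smul g f]
        exact hx.trans (le_pow_smul hX _ _)
      rw [thompsonSequence, mul_smul, mul_smul, hgt _ this, smul_inv_smul]
    apply HomeoPlus.ext_smul
    intro x
    rw [mul_smul, mul_smul]
    rcases le_total x (g • f • t) with h | h
    · rw [hx x h, hx (f • x)]
      rw [← hft (g • f • t) le_rfl]
      exact smul_le.2 h
    · rw [hft x h, hft]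
      rw [← hx (g • f • t) le_rfl]
      exact smul_le.2 h
  have hcommX : ∀ n, (g * f) * thompsonSequence (g * f) g (n + 1) =
      thompsonSequence (g * f) g (n + 2) * (g * f) := by
    intro n
    simp only [thompsonSequence, pow_succ' _ n, mul_inv_rev]
    group
  -- Since `f` commutes with these terms, `g` shifts them as `g * f` does. Conjugating by powers of
  -- `g * f` gives the remaining relations.
  have hcommg : ∀ n, 1 ≤ n → g * thompsonSequence (g * f) g (n + 1) =
      thompsonSequence (g * f) g (n + 2) * g := by
    intro n hn
    have h1 := hcommX n
    rw [mul_assoc, hcomm0 n hn, ← mul_assoc, ← mul_assoc] at h1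
    exact mul_right_cancel h1
  refine ⟨?_, ?_, ?_⟩
  · intro k n hkn
    rcases k with _ | k
    · obtain ⟨n, rfl⟩ := Nat.exists_eq_add_of_le' (show 1 ≤ n from hkn)
      exact hcommX n
    · obtain ⟨m, rfl⟩ := Nat.exists_eq_add_of_le (show k + 2 ≤ n from hkn)
      have h1 := hcommg (m + 1) (by omega)
      have h2 : ∀ j, thompsonSequence (g * f) g (k + j + 1) =
          (g * f) ^ k * thompsonSequence (g * f) g (j + 1) * ((g * f) ^ k)⁻¹ := by
        intro j
        simp only [thompsonSequence, pow_add, mul_inv_rev]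
        group
      have e1 : k + 2 + m = k + (m + 1) + 1 := by omega
      have e2 : k + (m + 1) + 1 + 1 = k + (m + 1 + 1) + 1 := by omega
      rw [e1, e2, h2, h2, show thompsonSequence (g * f) g (k + 1) =
        (g * f) ^ k * g * ((g * f) ^ k)⁻¹ from rfl]
      calc _ = (g * f) ^ k * (g * thompsonSequence (g * f) g (m + 1 + 1)) * ((g * f) ^ k)⁻¹ := by
            group
        _ = _ := by rw [h1]; group
  · rintro (_ | n) x
    · exact hX x
    · exact le_conj_smul hg x
  · rintro i
    refine ⟨(g * f) ^ i • t, ?_, fun k hk => ?_⟩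
    · rcases i with _ | n
      · simpa [thompsonSequence, mul_smul] using hlt
      · rw [thompsonSequence, mul_smul, mul_smul, pow_succ, mul_smul, mul_smul, inv_smul_smul,
          smul_lt]
        exact hlt'
    · obtain ⟨n, rfl⟩ := Nat.exists_eq_add_of_le (show i + 1 ≤ k from hk)
      have e : i + 1 + n = (i + n) + 1 := by omega
      rw [e, thompsonSequence, mul_smul, mul_smul, hgt, smul_inv_smul]
      apply inv_smul_le_of_le
      rw [pow_add, mul_smul, smul_le]
      exact le_pow_smul hX _ _

theorem a_smul (x : ℝ) : a • x = x + 1 := rfl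

theorem b_smul (x : ℝ) : b • x = bFun x := rfl

theorem b_inv_smul (x : ℝ) : b⁻¹ • x = bInv x := rfl

theorem isThompsonSequence_standard :
    IsThompsonSequence (thompsonSequence (b * (b⁻¹ * a)) b) := by
  have h : b • (b⁻¹ * a) • (0 : ℝ) = 1 := by
    rw [mul_smul, smul_inv_smul, a_smul, zero_add]
  -- Here `b⁻¹ * a` has support `(-∞, 1)`, and the product `a` carries `0` to `1`.
  refine isThompsonSequence_of_dynamics (t := 0) ?_ ?_ ?_ ?_ ?_ ?_
  · intro x
    rw [mul_smul, a_smul, b_inv_smul, bInv]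
    split_ifs <;> linarith
  · intro x
    rw [b_smul, bFun]
    split_ifs <;> linarith
  · intro x hx
    rw [b_smul, bFun, if_pos hx]
  · intro x hx
    rw [h] at hx
    rw [mul_smul, a_smul, b_inv_smul, bInv]
    split_ifs <;> linarith
  · rw [h]; norm_num
  · rw [h, b_smul, bFun]; norm_num

/-- Two homeomorphisms satisfying the dynamical condition generate a copy of Thompson's group. -/
theorem nonempty_mulEquiv_thompsonF {f g : HomeoPlus} {t : ℝ} (hf : ∀ x : ℝ, x ≤ f • x)
    (hg : ∀ x : ℝ, x ≤ g • x) (hgt : ∀ x ≤ t, g • x = x)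
    (hft : ∀ x : ℝ, g • f • t ≤ x → f • x = x) (hlt : t < g • f • t)
    (hlt' : g • f • t < g • g • f • t) :
    Nonempty (Subgroup.closure {f, g} ≃* thompsonF) := by
  have h := (isThompsonSequence_of_dynamics hf hg hgt hft hlt hlt').nonempty_mulEquiv
    isThompsonSequence_standard
  have e : Subgroup.closure {b⁻¹ * a, b} = thompsonF := by
    apply le_antisymm
    · have ha : a ∈ thompsonF := Subgroup.subset_closure (by simp)
      have hb : b ∈ thompsonF := Subgroup.subset_closure (by simp)
      rw [Subgroup.closure_le]
      rintro z (rfl | rfl)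
      · exact mul_mem (inv_mem hb) ha
      · exact hb
    · have ha : b⁻¹ * a ∈ Subgroup.closure {b⁻¹ * a, b} := Subgroup.subset_closure (by simp)
      have hb : b ∈ Subgroup.closure {b⁻¹ * a, b} := Subgroup.subset_closure (by simp)
      rw [thompsonF, Subgroup.closure_le]
      rintro z (rfl | rfl)
      · simpa using mul_mem hb ha
      · exact hb
  rwa [closure_range_thompsonSequence, closure_range_thompsonSequence, e] at h

/-! ### Pairs agreeing where they interact -/

/-- Let `f` and `h` agree on `[p, ∞)` and let `c` be the identity on `(-∞, p]`.  If every point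
which `f` or `c` moves is taken past `p` by `f`, then relations between `h` and `c` are relations
between `f` and `c`. -/
theorem lift_eq_one_of_agree {f h c : HomeoPlus} {p : ℝ} (hf : ∀ x : ℝ, x ≤ f • x)
    (hfh : ∀ x : ℝ, p ≤ x → h • x = f • x) (hc : ∀ x ≤ p, c • x = x)
    (hp : ∀ y : ℝ, (f • y = y ∧ c • y = y) ∨ ∃ n : ℕ, p ≤ f ^ n • y) (w : FreeGroup Bool)
    (hw : FreeGroup.lift (fun i => cond i h c) w = 1) :
    FreeGroup.lift (fun i => cond i f c) w = 1 := by
  -- `R x y` says that the `h`-orbit of `x` and the `f`-orbit of `y` merge beyond `p`: a partial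
  -- conjugacy between the two actions.
  let R : ℝ → ℝ → Prop := fun x y => ∃ n : ℕ, p ≤ f ^ n • y ∧ h ^ n • x = f ^ n • y
  have hup : ∀ (x y : ℝ) (n : ℕ), p ≤ f ^ n • y → h ^ n • x = f ^ n • y → ∀ m,
      p ≤ f ^ (n + m) • y ∧ h ^ (n + m) • x = f ^ (n + m) • y := by
    intro x y n h1 h2 m
    induction m with
    | zero => exact ⟨h1, h2⟩
    | succ m ih =>
      rw [← add_assoc, pow_succ', pow_succ', mul_smul, mul_smul, ih.2, hfh _ ih.1]
      exact ⟨ih.1.trans (hf _), rfl⟩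
  have hpow : ∀ (y : ℝ), p ≤ y → ∀ n : ℕ, p ≤ f ^ n • y ∧ h ^ n • y = f ^ n • y := by
    intro y hy n
    simpa using hup y y 0 (by simpa using hy) (by simp) n
  -- This makes `R` invariant under `c`: related points either coincide or both lie where `c` is the
  -- identity.
  have hR : ∀ x y, R x y → (x = y ∧ p ≤ x) ∨ (x < p ∧ y < p) := by
    rintro x y ⟨n, h1, h2⟩
    by_cases hy : p ≤ y
    · have := (hpow y hy n).2
      rw [← h2] at this
      have := smul_left_cancel _ this
      subst this
      exact Or.inl ⟨rfl, hy⟩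
    · by_cases hx : p ≤ x
      · have := (hpow x hx n).2
        rw [h2] at this
        exact Or.inl ⟨(smul_left_cancel _ this).symm, hx⟩
      · exact Or.inr ⟨not_le.1 hx, not_le.1 hy⟩
  have hRf : ∀ x y, R x y → R (h • x) (f • y) := by
    rintro x y ⟨n, h1, h2⟩
    refine ⟨n, ?_, ?_⟩
    · rw [← mul_smul, ← pow_succ, pow_succ', mul_smul]
      exact h1.trans (hf _)
    · rw [← mul_smul, ← mul_smul, ← pow_succ, ← pow_succ, pow_succ', pow_succ', mul_smul,
        mul_smul, h2, hfh _ h1]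
  have hRf' : ∀ x y, R x y → R (h⁻¹ • x) (f⁻¹ • y) := by
    rintro x y ⟨n, h1, h2⟩
    refine ⟨n + 1, ?_, ?_⟩
    · rwa [pow_succ, mul_smul, smul_inv_smul]
    · rwa [pow_succ, pow_succ, mul_smul, mul_smul, smul_inv_smul, smul_inv_smul]
  have hc' : ∀ x ≤ p, c⁻¹ • x = x := fun x hx => inv_smul_eq_self.2 (hc x hx)
  have hRc : ∀ d : HomeoPlus, (∀ x ≤ p, d • x = x) → ∀ x y, R x y → R (d • x) (d • y) := by
    intro d hd x y hxy
    rcases hR x y hxy with ⟨rfl, hx⟩ | ⟨hx, hy⟩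
    · refine ⟨0, ?_, rfl⟩
      rw [pow_zero, one_smul]
      calc p = d • p := (hd p le_rfl).symm
        _ ≤ d • x := smul_le.2 hx
    · rwa [hd x hx.le, hd y hy.le]
  have hRw : ∀ (w : FreeGroup Bool) (x y : ℝ), R x y →
      R (FreeGroup.lift (fun i => cond i h c) w • x)
        (FreeGroup.lift (fun i => cond i f c) w • y) := by
    intro w
    induction w using FreeGroup.induction_on with
    | C1 => intro x y hxy; simpa using hxy
    | of i =>
      intro x y hxy
      cases i
      · simpa using hRc c hc x y hxy
      · simpa using hRf x y hxy
    | inv_of i _ =>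
      intro x y hxy
      cases i
      · simpa using hRc c⁻¹ hc' x y hxy
      · simpa using hRf' x y hxy
    | mul u v hu hv =>
      intro x y hxy
      rw [_root_.map_mul, _root_.map_mul, mul_smul, mul_smul]
      exact hu _ _ (hv _ _ hxy)
  apply HomeoPlus.ext_smul
  intro y
  rw [one_smul]
  rcases hp y with ⟨h1, h2⟩ | ⟨n, hn⟩
  · have : ∀ w : FreeGroup Bool, FreeGroup.lift (fun i => cond i f c) w • y = y := by
      intro w
      induction w using FreeGroup.induction_on with
      | C1 => simp
      | of i => cases i <;> simp [h1, h2]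
      | inv_of i _ => cases i <;> simp [inv_smul_eq_self, h1, h2]
      | mul u v hu hv => rw [_root_.map_mul, mul_smul, hv, hu]
    exact this w
  -- As `w` is trivial for `h`, `c`, one point is related both to `y` and to the image of `y` under
  -- `w`; a common power of `f` then sends these to the same point.
  · have h0 : R ((h ^ n)⁻¹ • f ^ n • y) y := ⟨n, hn, by rw [smul_inv_smul]⟩
    have h1 := hRw w _ _ h0
    rw [hw, one_smul] at h1
    obtain ⟨k, hk1, hk2⟩ := h0
    obtain ⟨l, hl1, hl2⟩ := h1
    have e1 := (hup _ _ k hk1 hk2 l).2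
    have e2 := (hup _ _ l hl1 hl2 k).2
    rw [add_comm l k, e1] at e2
    exact (smul_left_cancel _ e2).symm

theorem nonempty_mulEquiv_of_agree {f h c : HomeoPlus} {p : ℝ} (hf : ∀ x : ℝ, x ≤ f • x)
    (hh : ∀ x : ℝ, x ≤ h • x) (hfh : ∀ x : ℝ, p ≤ x → h • x = f • x)
    (hc : ∀ x ≤ p, c • x = x)
    (hpf : ∀ y : ℝ, (f • y = y ∧ c • y = y) ∨ ∃ n : ℕ, p ≤ f ^ n • y)
    (hph : ∀ y : ℝ, (h • y = y ∧ c • y = y) ∨ ∃ n : ℕ, p ≤ h ^ n • y) :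
    Nonempty (Subgroup.closure {h, c} ≃* Subgroup.closure {f, c}) :=
  nonempty_closure_pair_mulEquiv _ _ _ _ fun w =>
    ⟨lift_eq_one_of_agree hf hfh hc hpf w,
      lift_eq_one_of_agree hh (fun x hx => (hfh x hx).symm) hc hph w⟩

/-! ### Linked intervals -/

/-- `J` ends at `s`, `K` begins at `t`, and they overlap in `(t, s)`. -/
structure Linked (J K : Set ℝ) (t s : ℝ) : Prop where
  lt : t < s
  left_sub : Set.Ico t s ⊆ J
  right_sub : Set.Ioc t s ⊆ K
  sub_Iio : J ⊆ Set.Iio s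
  sub_Ioi : K ⊆ Set.Ioi t

theorem leftEnd_le {J : Set ℝ} {x : ℝ} (hx : x ∈ J) : leftEnd J ≤ x :=
  sInf_le ⟨x, hx, rfl⟩

theorem le_leftEnd {J : Set ℝ} {c : EReal} (h : ∀ x ∈ J, c ≤ (x : EReal)) : c ≤ leftEnd J :=
  le_sInf (by rintro _ ⟨x, hx, rfl⟩; exact h x hx)

namespace Linked

variable {J K : Set ℝ} {t s : ℝ}

theorem inter_nonempty (h : Linked J K t s) : (J ∩ K).Nonempty := by
  obtain ⟨x, h1, h2⟩ := exists_between h.lt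
  exact ⟨x, h.left_sub ⟨h1.le, h2⟩, h.right_sub ⟨h1, h2.le⟩⟩

theorem inter_ssubset_left (h : Linked J K t s) : J ∩ K ⊂ J :=
  ⟨Set.inter_subset_left, fun hs =>
    lt_irrefl t (h.sub_Ioi (hs (h.left_sub ⟨le_rfl, h.lt⟩)).2)⟩

theorem inter_ssubset_right (h : Linked J K t s) : J ∩ K ⊂ K :=
  ⟨Set.inter_subset_right, fun hs =>
    lt_irrefl s (h.sub_Iio (hs (h.right_sub ⟨h.lt, le_rfl⟩)).1)⟩

theorem leftEnd_lt (h : Linked J K t s) (hJ : IsOpen J) : leftEnd J < leftEnd K := by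
  have ht := hJ.mem_nhds (h.left_sub ⟨le_rfl, h.lt⟩)
  obtain ⟨x, hxt, hx⟩ := exists_Ioc_subset_of_mem_nhds ht ⟨t - 1, by linarith⟩
  obtain ⟨y, h1, h2⟩ := exists_between hxt
  calc leftEnd J ≤ y := leftEnd_le (hx ⟨h1, h2.le⟩)
    _ < t := EReal.coe_lt_coe_iff.2 h2
    _ ≤ leftEnd K := le_leftEnd fun z hz => EReal.coe_le_coe_iff.2 (h.sub_Ioi hz).le

end Linked

/-- The order of left ends puts a point of `J` before all of `K`, and `K ⊄ J` puts a point of `K`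
after all of `J`. Hence `t = sInf K` and `s = sSup J` are finite. -/
theorem exists_linked {J K : Set ℝ} (hJ : IsOpen J) (hK : IsOpen K) (hJc : J.OrdConnected)
    (hKc : K.OrdConnected) (hne : (J ∩ K).Nonempty) (h : J ∩ K ⊂ K)
    (hlt : leftEnd J < leftEnd K) : ∃ t s, Linked J K t s := by
  obtain ⟨z, hzJ, hzK⟩ := hne
  obtain ⟨y, hyJ, hyK⟩ : ∃ y ∈ J, ∀ x ∈ K, y < x := by
    by_contra! hcon
    refine absurd hlt (not_lt.2 (le_leftEnd fun y hy => ?_))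
    obtain ⟨x, hx, hxy⟩ := hcon y hy
    exact (leftEnd_le hx).trans (EReal.coe_le_coe_iff.2 hxy)
  obtain ⟨u, huK, huJ⟩ : ∃ u ∈ K, u ∉ J := by
    obtain ⟨u, huK, hu⟩ := Set.exists_of_ssubset h
    exact ⟨u, huK, fun huJ => hu ⟨huJ, huK⟩⟩
  have hJu : ∀ x ∈ J, x < u := by
    intro x hx
    by_contra! hux
    exact huJ (hJc.out hyJ hx ⟨(hyK u huK).le, hux⟩)
  have hbK : BddBelow K := ⟨y, fun x hx => (hyK x hx).le⟩
  have hbJ : BddAbove J := ⟨u, fun x hx => (hJu x hx).le⟩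
  have htlt : ∀ x ∈ K, sInf K < x := by
    intro x hx
    obtain ⟨l, hl, hl'⟩ := exists_Ioc_subset_of_mem_nhds (hK.mem_nhds hx) ⟨x - 1, by linarith⟩
    obtain ⟨v, hv1, hv2⟩ := exists_between hl
    exact (csInf_le hbK (hl' ⟨hv1, hv2.le⟩)).trans_lt hv2
  have hlts : ∀ x ∈ J, x < sSup J := by
    intro x hx
    obtain ⟨l, hl, hl'⟩ := exists_Ico_subset_of_mem_nhds (hJ.mem_nhds hx) ⟨x + 1, by linarith⟩
    obtain ⟨v, hv1, hv2⟩ := exists_between hl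
    exact hv1.trans_le (le_csSup hbJ (hl' ⟨hv1.le, hv2⟩))
  have hyt : y ≤ sInf K := le_csInf ⟨z, hzK⟩ fun x hx => (hyK x hx).le
  have hsu : sSup J ≤ u := csSup_le ⟨z, hzJ⟩ fun x hx => (hJu x hx).le
  refine ⟨sInf K, sSup J, (htlt z hzK).trans (hlts z hzJ), ?_, ?_, hlts, htlt⟩
  · rintro x ⟨hx1, hx2⟩
    obtain ⟨v, hv, hxv⟩ := exists_lt_of_lt_csSup ⟨z, hzJ⟩ hx2
    exact hJc.out hyJ hv ⟨hyt.trans hx1, hxv.le⟩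
  · rintro x ⟨hx1, hx2⟩
    obtain ⟨v, hv, hxv⟩ := exists_lt_of_csInf_lt ⟨z, hzK⟩ hx1
    exact hKc.out hv huK ⟨hxv.le, hx2.trans hsu⟩

/-! ### Chains indexed by natural numbers -/

theorem isOpen_supp (f : HomeoPlus) : IsOpen (supp f) :=
  isOpen_ne_fun (continuous_smul_const f) continuous_id

/-- The first `n` terms of `F` are distinguished generators of an `n`-chain group. -/
structure IsChainSequence (n : ℕ) (F : ℕ → HomeoPlus) : Prop where
  ordConnected : ∀ i < n, (supp (F i)).OrdConnected
  le_smul : ∀ i < n, ∀ x : ℝ, x ≤ F i • x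
  disjoint : ∀ i k, i + 1 < k → k < n → ∀ x ∈ supp (F i), x ∉ supp (F k)
  linked : ∀ i, i + 1 < n → ∃ t s, Linked (supp (F i)) (supp (F (i + 1))) t s
  iso : ∀ i, i + 1 < n → Nonempty (Subgroup.closure {F i, F (i + 1)} ≃* thompsonF)

theorem IsChainSequence.isChainGroup {n : ℕ} {F : ℕ → HomeoPlus} (hn : 2 ≤ n)
    (h : IsChainSequence n F) :
    IsChainGroup n (Subgroup.closure (Set.range fun i : Fin n => F i)) := by
  have hlink : ∀ i k : Fin n, (i : ℕ) + 1 = k →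
      ∃ t s, Linked (supp (F i)) (supp (F k)) t s := by
    intro i k hik
    rw [← hik]
    exact h.linked i (by omega)
  refine ⟨fun i => F i, ⟨hn, ⟨fun i => isOpen_supp _, fun i => ?_, fun i => h.ordConnected i i.2,
    fun i k hik => ?_, fun i k hik => ?_, fun i k hik => ?_, fun i k hik => ?_⟩,
    fun i k hik => ?_, fun i => h.le_smul i i.2⟩, rfl, fun i k hik => ?_⟩
  · by_cases hi : (i : ℕ) + 1 < n
    · obtain ⟨t, s, hts⟩ := h.linked i hi
      exact hts.inter_nonempty.left
    · obtain ⟨t, s, hts⟩ := hlink ⟨i - 1, by omega⟩ i (by simp only; omega)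
      exact hts.inter_nonempty.right
  · rw [← Set.disjoint_iff_inter_eq_empty, Set.disjoint_left]
    exact fun x => h.disjoint i k hik k.2 x
  · obtain ⟨t, s, hts⟩ := hlink i k hik
    exact hts.inter_nonempty
  · obtain ⟨t, s, hts⟩ := hlink i k hik
    exact hts.inter_ssubset_left
  · obtain ⟨t, s, hts⟩ := hlink i k hik
    exact hts.inter_ssubset_right
  · obtain ⟨t, s, hts⟩ := hlink i k hik
    exact hts.leftEnd_lt (isOpen_supp _)
  · change Nonempty (Subgroup.closure {F i, F k} ≃* thompsonF)
    rw [← hik]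
    exact h.iso i (by omega)

theorem IsChainGroup.exists_isChainSequence {n : ℕ} {G : Subgroup HomeoPlus}
    (h : IsChainGroup n G) : 2 ≤ n ∧ ∃ F : ℕ → HomeoPlus, IsChainSequence n F ∧
      G = Subgroup.closure (Set.range fun i : Fin n => F i) := by
  obtain ⟨f, hp, rfl, hF⟩ := h
  obtain ⟨F, hval⟩ : ∃ F : ℕ → HomeoPlus, ∀ (i : ℕ) (hi : i < n), F i = f ⟨i, hi⟩ :=
    -- The value `1` beyond `n` is never consulted.
    ⟨fun i => if h : i < n then f ⟨i, h⟩ else 1, fun i hi => dif_pos hi⟩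
  refine ⟨hp.two_le, F, ⟨fun i hi => ?_, fun i hi => ?_, fun i k hik hk => ?_, fun i hi => ?_,
    fun i hi => ?_⟩, ?_⟩
  · rw [hval i hi]
    exact hp.chain.ordConnected _
  · rw [hval i hi]
    exact hp.le_apply _
  · rw [hval i (by omega), hval k hk]
    have := hp.chain.disjoint ⟨i, by omega⟩ ⟨k, hk⟩ hik
    rw [← Set.disjoint_iff_inter_eq_empty, Set.disjoint_left] at this
    exact fun x hx => this hx
  · rw [hval i (by omega), hval (i + 1) hi]
    exact exists_linked (isOpen_supp _) (isOpen_supp _) (hp.chain.ordConnected _)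
      (hp.chain.ordConnected _) (hp.chain.inter_nonempty _ _ rfl)
      (hp.chain.inter_ssubset_right _ _ rfl) (hp.leftEnd_lt _ _ rfl)
  · rw [hval i (by omega), hval (i + 1) hi]
    exact hF _ _ rfl
  · exact congrArg (fun g : Fin n → HomeoPlus => Subgroup.closure (Set.range g))
      (funext fun i => (hval i i.2).symm)

/-! ### Splitting the first generator -/

/-- `f` moves `r` to `t` and has support ending at `s`, `k` has support beginning at `t`, and
`k ∘ f` moves `t` past `s`. -/
structure StrongPair (f k : HomeoPlus) (r t s : ℝ) : Prop where
  lt : t < s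
  le_left : ∀ x : ℝ, x ≤ f • x
  le_right : ∀ x : ℝ, x ≤ k • x
  map_eq : f • r = t
  left_fix : ∀ x : ℝ, s ≤ x → f • x = x
  left_lt : ∀ x, r ≤ x → x < s → x < f • x
  right_fix : ∀ x ≤ t, k • x = x
  right_lt : ∀ x, t < x → x ≤ s → x < k • x
  le_map : s ≤ k • f • t

namespace StrongPair

variable {f k : HomeoPlus} {r t s : ℝ}

theorem lt' (h : StrongPair f k r t s) : r < t := by
  have h1 : r ≤ t := h.map_eq ▸ h.le_left r
  exact h.map_eq ▸ h.left_lt r le_rfl (h1.trans_lt h.lt)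

theorem left_smul_lt (h : StrongPair f k r t s) {x : ℝ} (hx : x < s) : f • x < s := by
  rw [← h.left_fix s le_rfl]
  exact smul_lt.2 hx

theorem smul_smul_eq (x : ℝ) : f • k • ((k⁻¹ * f * k)⁻¹ * f) • x = k • f • x := by
  simp only [← mul_smul]
  congr 1
  group

theorem commutator_smul_of_le (h : StrongPair f k r t s) {x : ℝ} (hx : x ≤ r) :
    ((k⁻¹ * f * k)⁻¹ * f) • x = x := by
  apply smul_left_cancel k
  apply smul_left_cancel f
  have h1 : f • x ≤ t := h.map_eq ▸ smul_le.2 hx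
  rw [smul_smul_eq, h.right_fix _ h1, h.right_fix x (hx.trans h.lt'.le)]

theorem commutator_smul_of_ge (h : StrongPair f k r t s) {x : ℝ} (hx : s ≤ x) :
    ((k⁻¹ * f * k)⁻¹ * f) • x = x := by
  apply smul_left_cancel k
  apply smul_left_cancel f
  rw [smul_smul_eq, h.left_fix _ hx, h.left_fix _ (hx.trans (h.le_right x))]

/-- After applying `f * k` the claim reads `f k x < k f x`. The cases are `x ≤ t`, where `k` fixes
`x` but moves `f x`; `k x < s`, where `s` separates the two sides; and `k x ≥ s`, where `f` fixes `k
x`. -/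
theorem lt_commutator_smul (h : StrongPair f k r t s) {x : ℝ} (h1 : r < x) (h2 : x < s) :
    x < ((k⁻¹ * f * k)⁻¹ * f) • x := by
  rw [← smul_lt (f := k), ← smul_lt (f := f), smul_smul_eq]
  have hft : t < f • x := h.map_eq ▸ smul_lt.2 h1
  rcases le_or_gt x t with hx | hx
  · rw [h.right_fix x hx]
    exact h.right_lt _ hft (h.left_smul_lt h2).le
  · rcases lt_or_ge (k • x) s with hk | hk
    · calc f • k • x < s := h.left_smul_lt hk
        _ ≤ k • f • t := h.le_map
        _ < k • f • x := smul_lt.2 (smul_lt.2 hx)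
    · rw [h.left_fix _ hk]
      exact smul_lt.2 (h.left_lt x (h.lt'.le.trans hx.le) h2)

theorem supp_commutator (h : StrongPair f k r t s) :
    supp ((k⁻¹ * f * k)⁻¹ * f) = Set.Ioo r s := by
  ext x
  rw [mem_supp]
  constructor
  · intro hx
    exact ⟨not_le.1 fun h1 => hx (h.commutator_smul_of_le h1),
      not_le.1 fun h1 => hx (h.commutator_smul_of_ge h1)⟩
  · rintro ⟨h1, h2⟩
    exact (h.lt_commutator_smul h1 h2).ne'

theorem le_commutator_smul (h : StrongPair f k r t s) (x : ℝ) :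
    x ≤ ((k⁻¹ * f * k)⁻¹ * f) • x := by
  rcases le_or_gt x r with h1 | h1
  · exact (h.commutator_smul_of_le h1).ge
  · rcases lt_or_ge x s with h2 | h2
    · exact (h.lt_commutator_smul h1 h2).le
    · exact (h.commutator_smul_of_ge h2).ge

theorem le_conj_inv_smul (h : StrongPair f k r t s) (x : ℝ) : x ≤ (k⁻¹ * f * k) • x := by
  simpa using le_conj_smul (g := k⁻¹) h.le_left x

theorem conj_inv_smul_of_ge (h : StrongPair f k r t s) {x : ℝ} (hx : k⁻¹ • s ≤ x) :
    (k⁻¹ * f * k) • x = x := by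
  have h1 : s ≤ k • x := by rwa [← smul_le (f := k), smul_inv_smul] at hx
  rw [mul_smul, mul_smul, h.left_fix _ h1, inv_smul_smul]

theorem inv_smul_le (h : StrongPair f k r t s) : k⁻¹ • s ≤ f • t :=
  inv_smul_le_of_le h.le_map

/-- Right of `k⁻¹ s` the commutator agrees with `f`. -/
theorem commutator_smul_eq (h : StrongPair f k r t s) {x : ℝ} (hx : k⁻¹ • s ≤ f • x) :
    ((k⁻¹ * f * k)⁻¹ * f) • x = f • x := by
  rw [mul_smul, inv_smul_eq_self.2 (h.conj_inv_smul_of_ge hx)]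

/-- The dynamical criterion holds at `r`: the conjugate sends `r` to `t`, the commutator sends `t`
to `f t`, and the conjugate fixes everything from `k⁻¹ s ≤ f t` on. -/
theorem nonempty_mulEquiv_conj_commutator (h : StrongPair f k r t s) :
    Nonempty (Subgroup.closure {k⁻¹ * f * k, (k⁻¹ * f * k)⁻¹ * f} ≃* thompsonF) := by
  have h1 : (k⁻¹ * f * k) • r = t := by
    rw [mul_smul, mul_smul, h.right_fix r h.lt'.le, h.map_eq, inv_smul_eq_self]
    exact h.right_fix t le_rfl
  have h2 : ((k⁻¹ * f * k)⁻¹ * f) • (k⁻¹ * f * k) • r = f • t := by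
    rw [h1, h.commutator_smul_eq h.inv_smul_le]
  have h3 : r < f • t := h.lt'.trans_le (h.le_left t)
  apply nonempty_mulEquiv_thompsonF (t := r) h.le_conj_inv_smul h.le_commutator_smul
  · exact fun x hx => h.commutator_smul_of_le hx
  · intro x hx
    rw [h2] at hx
    exact h.conj_inv_smul_of_ge (h.inv_smul_le.trans hx)
  · rwa [h2]
  · rw [h2]
    exact h.lt_commutator_smul h3 (h.left_smul_lt h.lt)

end StrongPair

theorem Linked.exists_strongPair {f g : HomeoPlus} {t s : ℝ}
    (h : Linked (supp f) (supp g) t s) (hfc : (supp f).OrdConnected)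
    (hf : ∀ x : ℝ, x ≤ f • x) (hg : ∀ x : ℝ, x ≤ g • x) :
    ∃ N : ℕ, StrongPair f (g ^ N) (f⁻¹ • t) t s := by
  have hft : f • t ≠ t := h.left_sub ⟨le_rfl, h.lt⟩
  have hfix : ∀ x : ℝ, s ≤ x → f • x = x := fun x hx => by
    by_contra hne
    exact absurd (h.sub_Iio hne) (not_lt.2 hx)
  have hgfix : ∀ x ≤ t, g • x = x := fun x hx => by
    by_contra hne
    exact absurd (h.sub_Ioi hne) (not_lt.2 hx)
  have hfts : f • t < s := by
    rw [← hfix s le_rfl]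
    exact smul_lt.2 h.lt
  have htf : t < f • t := lt_of_le_of_ne (hf t) hft.symm
  obtain ⟨N, hN⟩ := exists_le_pow_smul hg (y := f • t) (p := s)
    fun x h1 h2 => h.right_sub ⟨htf.trans_le h1, h2⟩
  have hle := le_pow_smul hg
  -- The exponent is visibly positive, so this power moves every point of `(t, s]`.
  refine ⟨N + 1, h.lt, hf, hle _, smul_inv_smul _ _, hfix, fun x h1 h2 => ?_,
    fun x hx => pow_smul_eq_self (hgfix x hx) _, fun x h1 h2 => ?_, ?_⟩
  · refine lt_of_le_of_ne (hf x) (Ne.symm ?_)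
    rcases le_total t x with hx | hx
    · exact h.left_sub ⟨hx, h2⟩
    · refine hfc.out (x := f⁻¹ • t) ?_ (h.left_sub ⟨le_rfl, h.lt⟩) ⟨h1, hx⟩
      rw [mem_supp, smul_inv_smul]
      exact fun he => hft (inv_smul_eq_self.1 he.symm)
  · rw [pow_succ, mul_smul]
    exact (lt_of_le_of_ne (hg x) (Ne.symm (h.right_sub ⟨h1, h2⟩))).trans_le (hle _ _)
  · rw [pow_succ', mul_smul]
    exact hN.trans (hg _)

/-- The commutator and the conjugate of `g` generate a copy of the group generated by `f`, `g`. -/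
theorem StrongPair.nonempty_mulEquiv_commutator {f g k : HomeoPlus} {r t s : ℝ}
    (h : StrongPair f k r t s) (hL : Linked (supp f) (supp g) t s)
    (hfc : (supp f).OrdConnected) :
    Nonempty (Subgroup.closure {(k⁻¹ * f * k)⁻¹ * f, f * g * f⁻¹} ≃*
      Subgroup.closure {f, g}) := by
  have hc : ∀ x ≤ f • t, (f * g * f⁻¹) • x = x := by
    intro x hx
    have h1 : g • f⁻¹ • x = f⁻¹ • x := by
      by_contra hne
      exact absurd (hL.sub_Ioi hne) (not_lt.2 (inv_smul_le_of_le hx))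
    rw [mul_smul, mul_smul, h1, smul_inv_smul]
  have hfts : f • t < s := h.left_smul_lt h.lt
  have hagree : ∀ x, f • t ≤ x → ((k⁻¹ * f * k)⁻¹ * f) • x = f • x := fun x hx =>
    h.commutator_smul_eq (h.inv_smul_le.trans (hx.trans (h.le_left x)))
  have e1 := nonempty_mulEquiv_of_agree (p := f • t) h.le_left h.le_commutator_smul hagree hc
    (fun y => ?_) (fun y => ?_)
  · have e2 := nonempty_closure_pair_conj f f g
    rw [mul_inv_cancel_right] at e2
    exact ⟨e1.some.trans e2.some⟩
  · by_cases hy : f • y = y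
    · rcases le_or_gt y (f • t) with h1 | h1
      · exact Or.inl ⟨hy, hc y h1⟩
      · exact Or.inr ⟨0, by simpa using h1.le⟩
    · refine Or.inr (exists_le_pow_smul h.le_left fun x h1 h2 => ?_)
      rcases le_total t x with hx | hx
      · exact hL.left_sub ⟨hx, h2.trans_lt hfts⟩
      · exact hfc.out hy (hL.left_sub ⟨le_rfl, h.lt⟩) ⟨h1, hx⟩
  · rcases le_or_gt y r with hy | hy
    · exact Or.inl ⟨h.commutator_smul_of_le hy,
        hc y (hy.trans (h.lt'.le.trans (h.le_left t)))⟩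
    · exact Or.inr (exists_le_pow_smul h.le_commutator_smul fun x h1 h2 =>
        (h.lt_commutator_smul (hy.trans_le h1) (h2.trans_lt hfts)).ne')

/-- The chain obtained by splitting the first generator in two. -/
def splitSequence (k : HomeoPlus) (F : ℕ → HomeoPlus) : ℕ → HomeoPlus
  | 0 => k⁻¹ * F 0 * k
  | 1 => (k⁻¹ * F 0 * k)⁻¹ * F 0
  | 2 => F 0 * F 1 * (F 0)⁻¹
  | i + 3 => F (i + 2)

/-- The first two new generators multiply to `F 0`, which then conjugates the third back to `F 1`.
-/
theorem closure_splitSequence {n : ℕ} (hn : 2 ≤ n) {F : ℕ → HomeoPlus} {k : HomeoPlus} {N : ℕ}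
    (hk : k = F 1 ^ N) :
    Subgroup.closure (Set.range fun i : Fin (n + 1) => splitSequence k F i) =
      Subgroup.closure (Set.range fun i : Fin n => F i) := by
  apply le_antisymm
  · have hmem : ∀ i < n, F i ∈ Subgroup.closure (Set.range fun i : Fin n => F i) :=
      fun i hi => Subgroup.subset_closure ⟨⟨i, hi⟩, rfl⟩
    have h0 := hmem 0 (by omega)
    have h1 := hmem 1 (by omega)
    have hk' : k ∈ Subgroup.closure (Set.range fun i : Fin n => F i) := hk ▸ pow_mem h1 N
    have h2 := mul_mem (mul_mem (inv_mem hk') h0) hk'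
    rw [Subgroup.closure_le]
    rintro _ ⟨⟨_ | _ | _ | i, hi⟩, rfl⟩
    · exact h2
    · exact mul_mem (inv_mem h2) h0
    · exact mul_mem (mul_mem h0 h1) (inv_mem h0)
    · exact hmem (i + 2) (by omega)
  · have hmem : ∀ i < n + 1, splitSequence k F i ∈
        Subgroup.closure (Set.range fun i : Fin (n + 1) => splitSequence k F i) :=
      fun i hi => Subgroup.subset_closure ⟨⟨i, hi⟩, rfl⟩
    have h0 : F 0 ∈ Subgroup.closure (Set.range fun i : Fin (n + 1) => splitSequence k F i) := by
      have := mul_mem (hmem 0 (by omega)) (hmem 1 (by omega))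
      simpa only [splitSequence, mul_inv_cancel_left] using this
    rw [Subgroup.closure_le]
    rintro _ ⟨⟨_ | _ | i, hi⟩, rfl⟩
    · exact h0
    · have := mul_mem (mul_mem (inv_mem h0) (hmem 2 (by omega))) h0
      have e : (F 0)⁻¹ * splitSequence k F 2 * F 0 = F 1 := by
        simp only [splitSequence]
        group
      rwa [e] at this
    · exact hmem (i + 3) (by omega)

theorem IsChainSequence.split {n : ℕ} {F : ℕ → HomeoPlus} (h : IsChainSequence n F)
    {k : HomeoPlus} {r t s : ℝ} (hn : 2 ≤ n) (hL : Linked (supp (F 0)) (supp (F 1)) t s)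
    (hS : StrongPair (F 0) k r t s) : IsChainSequence (n + 1) (splitSequence k F) := by
  have hc0 := h.ordConnected 0 (by omega)
  have hr0 : r ∈ supp (F 0) := (hS.left_lt r le_rfl (hS.lt'.trans hS.lt)).ne'
  have hsub0 : ∀ x, r ≤ x → x < s → x ∈ supp (F 0) := fun x h1 h2 => (hS.left_lt x h1 h2).ne'
  have s0 : supp (k⁻¹ * F 0 * k) = (fun x : ℝ => k • x) ⁻¹' supp (F 0) := by
    simpa using supp_conj (F 0) k⁻¹
  have s1 := hS.supp_commutator
  have s2 := supp_conj (F 1) (F 0)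
  have mem2 : ∀ x, s ≤ x → (x ∈ supp (F 0 * F 1 * (F 0)⁻¹) ↔ x ∈ supp (F 1)) := by
    intro x hx
    rw [s2, Set.mem_preimage, inv_smul_eq_self.2 (hS.left_fix x hx)]
  have sub0 : ∀ x ∈ supp (k⁻¹ * F 0 * k), x ∈ supp (F 0) ∧ x < k⁻¹ • s := by
    intro x hx
    have h1 : x < k⁻¹ • s := by
      by_contra! hge
      exact hx (hS.conj_inv_smul_of_ge hge)
    refine ⟨?_, h1⟩
    rw [s0] at hx
    rcases le_or_gt x t with hxt | hxt
    · rwa [Set.mem_preimage, hS.right_fix x hxt] at hx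
    · exact hsub0 x (hS.lt'.le.trans hxt.le)
        (h1.trans_le (hS.inv_smul_le.trans (hS.left_smul_lt hS.lt).le))
  have sub2 : ∀ x ∈ supp (F 0 * F 1 * (F 0)⁻¹), F 0 • t < x := by
    intro x hx
    rw [s2] at hx
    have := hL.sub_Ioi hx
    rwa [Set.mem_Ioi, ← smul_lt (f := F 0), smul_inv_smul] at this
  have hrt : r < F 0 • t := hS.lt'.trans_le (hS.le_left t)
  -- Otherwise `supp (F 0)` and `supp (F 2)` would meet. Beyond `s` conjugation by `F 0` has no
  -- effect, so the link to `F 2` survives.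
  have hst : ∀ t' s', 2 < n → Linked (supp (F 1)) (supp (F 2)) t' s' → s ≤ t' := by
    intro t' s' h2 hL'
    by_contra! hlt
    obtain ⟨x, h3, h4⟩ := exists_between (lt_min hlt hL'.lt)
    rw [lt_min_iff] at h4
    have htt' : t < t' := hL.sub_Ioi (hL'.left_sub ⟨le_rfl, hL'.lt⟩)
    exact h.disjoint 0 2 (by omega) h2 x (hL.left_sub ⟨(htt'.trans h3).le, h4.1⟩)
      (hL'.right_sub ⟨h3, h4.2.le⟩)
  refine ⟨?_, ?_, ?_, ?_, ?_⟩
  · rintro (_ | _ | _ | i) hi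
    · simp only [splitSequence]
      rw [s0]
      exact hc0.preimage_mono (smul_strictMono k).monotone
    · simp only [splitSequence]
      rw [s1]
      exact Set.ordConnected_Ioo
    · simp only [splitSequence]
      rw [s2]
      exact (h.ordConnected 1 (by omega)).preimage_mono (smul_strictMono _).monotone
    · exact h.ordConnected (i + 2) (by omega)
  · rintro (_ | _ | _ | i) hi
    · exact hS.le_conj_inv_smul
    · exact hS.le_commutator_smul
    · exact le_conj_smul (h.le_smul 1 (by omega))
    · exact h.le_smul (i + 2) (by omega)
  · rintro (_ | _ | _ | i) j hij hj x hx
    · obtain ⟨h1, h2⟩ := sub0 x hx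
      obtain ⟨_ | j, rfl⟩ := Nat.exists_eq_add_of_le' (show 2 ≤ j from hij)
      · intro hx'
        exact absurd (h2.trans_le hS.inv_smul_le) (not_lt.2 (sub2 x hx').le)
      · exact h.disjoint 0 (j + 2) (by omega) (by omega) x h1
    · obtain ⟨j, rfl⟩ := Nat.exists_eq_add_of_le' (show 3 ≤ j from hij)
      simp only [splitSequence] at hx
      rw [s1] at hx
      exact h.disjoint 0 (j + 2) (by omega) (by omega) x (hsub0 x hx.1.le hx.2)
    · obtain ⟨j, rfl⟩ := Nat.exists_eq_add_of_le' (show 4 ≤ j from hij)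
      by_cases hx0 : x ∈ supp (F 0)
      · exact h.disjoint 0 (j + 3) (by omega) (by omega) x hx0
      · have h1 : (F 0)⁻¹ • x = x := inv_smul_eq_self.2 (not_not.1 hx0)
        simp only [splitSequence] at hx
        rw [s2, Set.mem_preimage, h1] at hx
        exact h.disjoint 1 (j + 3) (by omega) (by omega) x hx
    · obtain ⟨j, rfl⟩ := Nat.exists_eq_add_of_le' (show 3 ≤ j by omega)
      exact h.disjoint (i + 2) (j + 2) (by omega) (by omega) x hx
  · rintro (_ | _ | _ | i) hi
    · refine ⟨r, k⁻¹ • s, ?_, ?_, ?_, fun x hx => (sub0 x hx).2, ?_⟩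
      · exact hS.lt'.trans (by
          rw [← smul_lt (f := k), smul_inv_smul, hS.right_fix t le_rfl]
          exact hS.lt)
      · rintro x ⟨h1, h2⟩
        simp only [splitSequence]
        rw [s0, Set.mem_preimage]
        refine hsub0 _ (h1.trans (hS.le_right x)) ?_
        rwa [← smul_lt (f := k), smul_inv_smul] at h2
      · rintro x ⟨h1, h2⟩
        simp only [splitSequence]
        rw [s1]
        exact ⟨h1, h2.trans_lt (hS.inv_smul_le.trans_lt (hS.left_smul_lt hS.lt))⟩
      · simp only [splitSequence]
        rw [s1]
        exact fun x hx => hx.1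
    · refine ⟨F 0 • t, s, hS.left_smul_lt hS.lt, ?_, ?_, ?_, fun x hx => sub2 x hx⟩
      · simp only [splitSequence]
        rw [s1]
        exact fun x hx => ⟨hrt.trans_le hx.1, hx.2⟩
      · rintro x ⟨h1, h2⟩
        simp only [splitSequence]
        rw [s2, Set.mem_preimage]
        refine hL.right_sub ⟨?_, inv_smul_le_of_le (h2.trans (hS.le_left s) |>.trans ?_)⟩
        · rwa [← smul_lt (f := F 0), smul_inv_smul]
        · exact le_rfl
      · simp only [splitSequence]
        rw [s1]
        exact fun x hx => hx.2
    · obtain ⟨t', s', hL'⟩ := h.linked 1 (by omega)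
      have hs := hst t' s' (by omega) hL'
      refine ⟨t', s', hL'.lt, fun x hx => ?_, hL'.right_sub, fun x hx => ?_, hL'.sub_Ioi⟩
      · exact (mem2 x (hs.trans hx.1)).2 (hL'.left_sub hx)
      · rw [Set.mem_Iio]
        by_contra! hge
        exact absurd (hL'.sub_Iio ((mem2 x ((hs.trans hL'.lt.le).trans hge)).1 hx)) (not_lt.2 hge)
    · exact h.linked (i + 2) (by omega)
  · rintro (_ | _ | _ | i) hi
    · exact hS.nonempty_mulEquiv_conj_commutator
    · exact ⟨(hS.nonempty_mulEquiv_commutator hL hc0).some.trans (h.iso 0 (by omega)).some⟩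
    · have hcomm : F 0 * F 2 * (F 0)⁻¹ = F 2 := by
        apply HomeoPlus.ext_smul
        intro x
        obtain ⟨t', s', hL'⟩ := h.linked 1 (by omega)
        have hs := hst t' s' (by omega) hL'
        have hfix : ∀ y ≤ s, F 2 • y = y := fun y hy => by
          by_contra hne
          exact absurd (hL'.sub_Ioi hne) (not_lt.2 (hy.trans hs))
        rw [mul_smul, mul_smul]
        rcases le_or_gt x s with hx | hx
        · rw [hfix x hx, hfix, smul_inv_smul]
          exact inv_smul_le_of_le (hx.trans (hS.le_left s))
        · rw [inv_smul_eq_self.2 (hS.left_fix x hx.le)]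
          exact hS.left_fix _ (hx.le.trans (h.le_smul 2 (by omega) x))
      have e := nonempty_closure_pair_conj (F 0) (F 1) (F 2)
      rw [hcomm] at e
      exact ⟨e.some.trans (h.iso 1 (by omega)).some⟩
    · exact h.iso (i + 2) (by omega)

theorem IsChainGroup.succ {n : ℕ} {G : Subgroup HomeoPlus} (h : IsChainGroup n G) :
    IsChainGroup (n + 1) G := by
  obtain ⟨hn, F, hF, rfl⟩ := h.exists_isChainSequence
  obtain ⟨t, s, hL⟩ := hF.linked 0 (by omega)
  obtain ⟨N, hS⟩ := hL.exists_strongPair (hF.ordConnected 0 (by omega)) (hF.le_smul 0 (by omega))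
    (hF.le_smul 1 (by omega))
  rw [← closure_splitSequence hn (N := N) rfl]
  exact (hF.split hn hL hS).isChainGroup (by omega)

end ChainGroup

theorem mainTheorem9 (n m : ℕ) (hn : 2 ≤ n) (hnm : n ≤ m)
    (G : Subgroup ChainGroup.HomeoPlus) (hG : ChainGroup.IsChainGroup n G) :
    ∃ H : Subgroup ChainGroup.HomeoPlus,
      ChainGroup.IsChainGroup m H ∧ Nonempty (G ≃* H) := by
  -- The group is kept; only its generators change.
  refine ⟨G, ?_, ⟨MulEquiv.refl G⟩⟩
  induction m, hnm using Nat.le_induction with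
  | base => exact hG
  | succ m _ ih => exact ih.succ
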